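/- **Proposition 3.1.** Let $\mathbb F$ be a field of characteristic zero and let $\Gamma$ be a nonzero additive subgroup of $\mathbb F$. Let $\mathscr W(\Gamma)=\mathbb F[\Gamma]\partial$, where $\mathbb F[\Gamma]$ is the group algebra of $\Gamma$ with basis $\{e^\alpha\mid\alpha\in\Gamma\}$ and $\partial(e^\alpha)=\alpha e^\alpha$, with the bracket $[f\partial,g\partial]=(f\,\partial(g)-g\,\partial(f))\partial$. Let $\mathscr L=\mathscr W(\Gamma)\otimes\mathbb F[t,t^{-1}]$ be the generalized loop Virasoro algebra, that is, the Lie algebra over $\mathbb F$ with basis $L_{\alpha,i}=e^\alpha\partial\otimes t^i$ ($\alpha\in\Gamma$, $i\in\mathbb Z$) and brackets $$[L_{\alpha,i},L_{\beta,j}]=(\beta-\alpha)L_{\alpha+\beta,\,i+j}.$$ Let $V=\mathscr L\otimes_{\mathbb F}\mathscr L$ be the $\mathscr L$-module with the adjoint diagonal action $x\cdot(a\otimes b)=[x,a]\otimes b+a\otimes[x,b]$. Then every derivation from $\mathscr L$ to $V$, i.e. every $\mathbb F$-linear map $D:\mathscr L\to V$ with $D([x,y])=x\cdot D(y)-y\cdot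 D(x)$ for all $x,y\in\mathscr L$, is inner: there is $v\in V$ with $D(x)=x\cdot v$ for all $x\in\mathscr L$. Equivalently, the first Lie algebra cohomology group vanishes: $H^1(\mathscr L,V)=0$. -/

import Mathlib

open scoped TensorProduct

noncomputable section

/-- The degree operator `∂` on the group algebra `F[Γ]`: `∂(e^α) = α e^α`. -/
def groupAlgebraDeg (F : Type*) [Field F] (Γ : AddSubgroup F) :
    AddMonoidAlgebra F Γ →ₗ[F] AddMonoidAlgebra F Γ :=
  (AddMonoidAlgebra.basis Γ F).constr F
    (fun α : Γ => AddMonoidAlgebra.single α (α : F))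

theorem groupAlgebraDeg_single {F : Type*} [Field F] (Γ : AddSubgroup F) (α : Γ) (c : F) :
    groupAlgebraDeg F Γ (AddMonoidAlgebra.single α c)
      = AddMonoidAlgebra.single α ((α : F) * c) := by
  have h : (AddMonoidAlgebra.single α c : AddMonoidAlgebra F Γ)
      = c • AddMonoidAlgebra.basis Γ F α := by
    simp
  rw [h, map_smul, groupAlgebraDeg, Module.Basis.constr_basis]
  simp [mul_comm]

/-- `∂` is a derivation of the group algebra. -/
theorem groupAlgebraDeg_mul {F : Type*} [Field F] (Γ : AddSubgroup F)
    (f g : AddMonoidAlgebra F Γ) :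
    groupAlgebraDeg F Γ (f * g)
      = groupAlgebraDeg F Γ f * g + f * groupAlgebraDeg F Γ g := by
  induction f using AddMonoidAlgebra.induction_linear with
  | zero => simp
  | add f₁ f₂ h₁ h₂ => rw [add_mul, map_add, h₁, h₂, map_add]; ring
  | single α a =>
    induction g using AddMonoidAlgebra.induction_linear with
    | zero => simp
    | add g₁ g₂ h₁ h₂ => rw [mul_add, map_add, h₁, h₂, map_add]; ring
    | single β b =>
      simp only [groupAlgebraDeg_single, AddMonoidAlgebra.single_mul_single,
        ← AddMonoidAlgebra.single_add, AddSubgroup.coe_add]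
      congr 1
      ring

/-- The generalized Witt algebra `W(Γ) = F[Γ]∂`: the element `f∂` is represented by its
coefficient `f ∈ F[Γ]`. (A type synonym, since it carries its own Lie bracket.) -/
def WittAlg (F : Type*) [Field F] (Γ : AddSubgroup F) : Type _ := AddMonoidAlgebra F Γ

namespace WittAlg

variable {F : Type*} [Field F] {Γ : AddSubgroup F}

instance : AddCommGroup (WittAlg F Γ) := inferInstanceAs (AddCommGroup (AddMonoidAlgebra F Γ))

instance : Module F (WittAlg F Γ) := inferInstanceAs (Module F (AddMonoidAlgebra F Γ))

/-- The linear identification `f ↦ f∂` of `F[Γ]` with `W(Γ)`. -/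
def ofCoef : AddMonoidAlgebra F Γ ≃ₗ[F] WittAlg F Γ := LinearEquiv.refl F _

/-- The inverse identification `f∂ ↦ f`. -/
def coef : WittAlg F Γ ≃ₗ[F] AddMonoidAlgebra F Γ := ofCoef.symm

theorem coef_ofCoef (f : AddMonoidAlgebra F Γ) : coef (ofCoef f : WittAlg F Γ) = f := rfl

/-- The commutator of vector fields: `[f∂, g∂] = (f ∂(g) - g ∂(f)) ∂`. -/
instance : Bracket (WittAlg F Γ) (WittAlg F Γ) where
  bracket u v :=
    ofCoef (coef u * groupAlgebraDeg F Γ (coef v) - coef v * groupAlgebraDeg F Γ (coef u))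

theorem coef_lie (u v : WittAlg F Γ) :
    coef ⁅u, v⁆
      = coef u * groupAlgebraDeg F Γ (coef v) - coef v * groupAlgebraDeg F Γ (coef u) := rfl

instance : LieRing (WittAlg F Γ) where
  add_lie u v w := by
    apply coef.injective
    simp only [coef_lie, map_add]
    ring
  lie_add u v w := by
    apply coef.injective
    simp only [coef_lie, map_add]
    ring
  lie_self u := by
    apply coef.injective
    simp only [coef_lie, map_zero, sub_self]
  leibniz_lie u v w := by
    apply coef.injective
    simp only [coef_lie, map_add, map_sub, groupAlgebraDeg_mul]
    ring

instance : LieAlgebra F (WittAlg F Γ) where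
  lie_smul c u v := by
    apply coef.injective
    simp only [coef_lie, map_smul, mul_smul_comm, smul_mul_assoc, smul_sub]

/-- The basis vector `L_α = e^α ∂`. -/
def L (α : Γ) : WittAlg F Γ := ofCoef (AddMonoidAlgebra.single α 1)

theorem lie_L (α β : Γ) :
    ⁅(L α : WittAlg F Γ), L β⁆ = ((β : F) - (α : F)) • L (α + β) := by
  apply coef.injective
  simp only [coef_lie, L, coef_ofCoef, map_smul, groupAlgebraDeg_single,
    AddMonoidAlgebra.single_mul_single, AddMonoidAlgebra.smul_single, add_comm β α,
    ← AddMonoidAlgebra.single_sub]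
  congr 1
  simp

end WittAlg

/-- The generalized loop Virasoro algebra `W(Γ) ⊗ F[t, t⁻¹]` with the bracket
`[u tⁱ, v tʲ] = [u, v] tⁱ⁺ʲ`. Mathlib writes the Laurent polynomial factor, which is the group
algebra of `ℤ`, on the left. -/
abbrev LoopVir (F : Type*) [Field F] (Γ : AddSubgroup F) : Type _ :=
  LieAlgebra.loopAlgebra F ℤ (WittAlg F Γ)

namespace LoopVir

variable {F : Type*} [Field F] {Γ : AddSubgroup F}

/-- The basis vector `L_{α,i} = L_α tⁱ`. -/
def L (α : Γ) (i : ℤ) : LoopVir F Γ :=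
  (AddMonoidAlgebra.single i 1 : AddMonoidAlgebra F ℤ) ⊗ₜ[F] WittAlg.L α

theorem lie_L (α β : Γ) (i j : ℤ) :
    ⁅(L α i : LoopVir F Γ), L β j⁆ = ((β : F) - (α : F)) • L (α + β) (i + j) := by
  simp only [L, LieAlgebra.ExtendScalars.bracket_tmul, WittAlg.lie_L,
    AddMonoidAlgebra.single_mul_single, mul_one, TensorProduct.tmul_smul]

end LoopVir

/-- The coboundary operator in degree zero, `m ↦ (x ↦ x · m)`, from a Lie module `M` to the
`1`-cochains of `L` with coefficients in `M`. -/
def lieD₀₁ (R L M : Type*) [CommRing R] [LieRing L] [LieAlgebra R L]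
    [AddCommGroup M] [Module R M] [LieRingModule L M] [LieModule R L M] :
    M →ₗ[R] LieModule.Cohomology.oneCochain R L M :=
  (LieModule.toEnd R L M : L →ₗ[R] Module.End R M).flip

theorem lieD₀₁_apply (R L M : Type*) [CommRing R] [LieRing L] [LieAlgebra R L]
    [AddCommGroup M] [Module R M] [LieRingModule L M] [LieModule R L M] (m : M) (x : L) :
    lieD₀₁ R L M m x = ⁅x, m⁆ := rfl

/-- The first Chevalley-Eilenberg cohomology `H¹(L, M)`: `1`-cocycles modulo `1`-coboundaries. -/
abbrev LieH1 (R L M : Type*) [CommRing R] [LieRing L] [LieAlgebra R L]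
    [AddCommGroup M] [Module R M] [LieRingModule L M] [LieModule R L M] : Type _ :=
  LinearMap.ker (LieModule.Cohomology.d₁₂ R L M) ⧸
    (LinearMap.range (lieD₀₁ R L M)).submoduleOf
      (LinearMap.ker (LieModule.Cohomology.d₁₂ R L M))

end

/-!
Expanding `𝓛 ⊗ 𝓛` in the vectors `L_β ⊗ L_γ`, the coefficients lie in the domain
`R = F[t^±¹, s^±¹]`, where `t` and `s` are the loop parameters of the two tensor factors, and
`L_{α,i}` acts by
`(L_{α,i} m)(β, γ) = tⁱ (β - 2α) m(β - α, γ) + sⁱ (γ - 2α) m(β, γ - α)` (`LoopVir.act`). This action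
is `R`-linear, so a derivation `D` may be multiplied by `t - s`.

The elements `L_{0,i}` commute with each other and act diagonally, by `β tⁱ + γ sⁱ`. Two
consequences follow. By the eigenvalues of `L_{0,0}`, the part of `D` that does not preserve weights
is inner, and by commutativity the component of `D(L_{0,i})` along `L_β ⊗ L_{-β}` with `β ≠ 0` is a
multiple of `(tⁱ - sⁱ) / (t - s)`. Hence `(t - s) D` differs by an inner derivation from a `D'` that
preserves weights and sends every `L_{0,i}` to a multiple of `L_0 ⊗ L_0`. For such `D'` the identity
`α L_{α,i+j} = [L_{0,i}, L_{α,j}]` kills all components of `D'(L_{α,i})` except those along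
`L_α ⊗ L_0` and `L_0 ⊗ L_α` (`LoopVir.IsCocycle.eq_zero_of_ne`) and gives `D'(L_{0,i}) = 0`
(`LoopVir.IsCocycle.apply_zero`). The brackets `[L_{α,0}, L_{β,0}]` then show that `D'` is the
coboundary of a multiple of `L_0 ⊗ L_0` (`LoopVir.IsCocycle.exists_eq_act`).

So `(t - s) D` is the coboundary of some `w`, and `w` is invariant modulo `t - s`. As `Γ` is infinite
and `w` has finite support, there are no nonzero invariants (`LoopVir.dvd_of_dvd_act`). Thus
`w = (t - s) v`, and cancelling `t - s` shows that `D` is the coboundary of `v`.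
-/

namespace LoopVir

/-! ### Cocycles in coordinates -/

section Core

variable {F R : Type*} [Field F] {Γ : AddSubgroup F} [CommRing R] [Algebra F R]

variable (R) in
/-- The inclusion of `Γ` into an `F`-algebra `R`, as scalars. -/
def weight : Γ →+ R := (algebraMap F R).toAddMonoidHom.comp Γ.subtype

theorem weight_apply (α : Γ) : weight R α = algebraMap F R (α : F) := rfl

theorem weight_inv_mul {α : Γ} (hα : α ≠ 0) :
    algebraMap F R (α : F)⁻¹ * weight R α = 1 := by
  rw [weight_apply, ← map_mul, inv_mul_cancel₀ (by simpa using hα), map_one]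

theorem weight_ne_zero [Nontrivial R] {α : Γ} (hα : α ≠ 0) : weight R α ≠ 0 :=
  right_ne_zero_of_mul_eq_one (weight_inv_mul hα)

/-- The action of `L_{α,i}` on `𝓛 ⊗ 𝓛` in coordinates. An element `∑ m(β,γ) L_β ⊗ L_γ` with
coefficients in `R = F[t^±¹, s^±¹]` is encoded by the function `m`; the variables `t` and `s` are
the loop parameters of the two tensor factors. -/
def act (t s : Rˣ) (α : Γ) (i : ℤ) (m : Γ × Γ → R) (p : Γ × Γ) : R :=
  ((t ^ i : Rˣ) : R) * weight R (p.1 - 2 • α) * m (p.1 - α, p.2)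
    + ((s ^ i : Rˣ) : R) * weight R (p.2 - 2 • α) * m (p.1, p.2 - α)

/-- The derivation identity on the basis vectors `L_{α,i}`, in coordinates. -/
def IsCocycle (t s : Rˣ) (d : Γ → ℤ → Γ × Γ → R) : Prop :=
  ∀ α β i j p, weight R (β - α) * d (α + β) (i + j) p
    = act t s α i (d β j) p - act t s β j (d α i) p

variable {t s : Rˣ}

theorem act_act_sub (α β : Γ) (i j : ℤ) (m : Γ × Γ → R) (p : Γ × Γ) :
    act t s α i (act t s β j m) p - act t s β j (act t s α i m) p
      = weight R (β - α) * act t s (α + β) (i + j) m p := by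
  obtain ⟨a, b⟩ := p
  simp only [act, sub_sub, add_comm β α, zpow_add, Units.val_mul, map_sub, map_add, map_nsmul,
    nsmul_eq_mul]
  push_cast
  ring

theorem act_sub (α : Γ) (i : ℤ) (m n : Γ × Γ → R) (p : Γ × Γ) :
    act t s α i (fun q => m q - n q) p = act t s α i m p - act t s α i n p := by
  simp only [act]; ring

theorem act_mul (α : Γ) (i : ℤ) (r : R) (m : Γ × Γ → R) (p : Γ × Γ) :
    act t s α i (fun q => r * m q) p = r * act t s α i m p := by
  simp only [act]; ring

theorem act_zero_left (i : ℤ) (m : Γ × Γ → R) (p : Γ × Γ) :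
    act t s 0 i m p
      = (((t ^ i : Rˣ) : R) * weight R p.1 + ((s ^ i : Rˣ) : R) * weight R p.2) * m p := by
  simp only [act, smul_zero, sub_zero]; ring

theorem IsCocycle.mul_sub_act {d : Γ → ℤ → Γ × Γ → R} (hd : IsCocycle t s d) (r : R)
    (m : Γ × Γ → R) : IsCocycle t s (fun α i p => r * d α i p - act t s α i m p) := by
  intro α β i j p
  simp only [act_sub, act_mul]
  linear_combination r * hd α β i j p + act_act_sub (t := t) (s := s) α β i j m p

/-! ### Absence of invariants modulo an element -/

theorem infinite_of_ne_bot [CharZero F] (hΓ : Γ ≠ ⊥) : Infinite Γ := by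
  obtain ⟨a, ha, h⟩ := Γ.bot_or_exists_ne_zero.resolve_left hΓ
  refine Infinite.of_injective (fun n : ℕ => n • (⟨a, ha⟩ : Γ)) fun m n hmn => ?_
  have := congrArg Subtype.val hmn
  simpa [h] using this

/-- Invariants of `W(Γ) ⊗ W(Γ)` over `R / (r)` vanish: translating a nonzero coefficient of
finitely supported `m` by a suitable `α` isolates it in the action of `L_α`. -/
theorem dvd_of_dvd_act [CharZero F] (hΓ : Γ ≠ ⊥) (r : R) (m : Γ × Γ →₀ R)
    (h : ∀ α p, r ∣ act t s α 0 m p) (p : Γ × Γ) : r ∣ m p := by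
  classical
  have := infinite_of_ne_bot hΓ
  obtain ⟨β, γ⟩ := p
  obtain ⟨α, hα⟩ := Infinite.exists_notMem_finset
    (insert β (m.support.image fun q => q.1 - β))
  simp only [Finset.mem_insert, not_or, Finset.mem_image, Finsupp.mem_support_iff, not_exists,
    not_and] at hα
  have hm : m (β + α, γ - α) = 0 := by
    by_contra hne
    exact hα.2 _ hne (by simp)
  have h1 := h α (β + α, γ)
  simp only [act, hm, add_sub_cancel_right, zpow_zero, Units.val_one, one_mul, mul_zero,
    add_zero] at h1
  have e : β + α - 2 • α = β - α := by rw [two_nsmul]; abel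
  rw [e] at h1
  have hβ : β - α ≠ 0 := sub_ne_zero.mpr (Ne.symm hα.1)
  have h2 := h1.mul_left (algebraMap F R ((β - α : Γ) : F)⁻¹)
  rwa [← mul_assoc, weight_inv_mul hβ, one_mul] at h2

/-! ### Weight-preserving cocycles -/

variable [IsDomain R]

/-- A cocycle whose value at the grading element `L_{0,0}` has total weight zero preserves
weights: comparing the eigenvalues of `L_{0,0}` on both sides leaves no other component. -/
theorem IsCocycle.eq_zero_of_add_ne {d : Γ → ℤ → Γ × Γ → R} (hd : IsCocycle t s d)
    (h0 : ∀ p : Γ × Γ, p.1 + p.2 ≠ 0 → d 0 0 p = 0) (α : Γ) (i : ℤ) (p : Γ × Γ)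
    (hp : p.1 + p.2 ≠ α) : d α i p = 0 := by
  have h := hd 0 α 0 i p
  have h1 : act t s α i (d 0 0) p = 0 := by
    rw [act, h0 (p.1 - α, p.2), h0 (p.1, p.2 - α)]
    · simp
    · intro h; apply hp
      rw [← sub_eq_zero, add_sub_assoc]; exact h
    · intro h; apply hp
      rw [← sub_eq_zero, add_sub_right_comm]; exact h
  rw [h1, act_zero_left] at h
  have hw := weight_ne_zero (R := R) (sub_ne_zero.mpr hp)
  refine (mul_eq_zero.mp ?_).resolve_left hw
  simp only [map_sub, map_add, sub_zero, zero_add, zpow_zero, Units.val_one] at h ⊢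
  linear_combination -h

/-- For `α ≠ 0` the value at `L_{α,i}` has no components away from `L_α ⊗ L_0` and `L_0 ⊗ L_α`:
for `β + γ = α`, raising the loop degree by `i` multiplies the component along `L_β ⊗ L_γ` by
`(β tⁱ + γ sⁱ) / (β + γ)`, and for `β, γ ≠ 0` this factor is not multiplicative in `i`. -/
theorem IsCocycle.eq_zero_of_ne {d : Γ → ℤ → Γ × Γ → R} (hd : IsCocycle t s d)
    (hts : (t : R) ≠ s) (h0 : ∀ i, ∀ p : Γ × Γ, p ≠ 0 → d 0 i p = 0)
    (α : Γ) (hα : α ≠ 0) (i : ℤ) (p : Γ × Γ) (h1 : p.1 ≠ 0) (h2 : p.2 ≠ 0) : d α i p = 0 := by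
  by_cases hp : p.1 + p.2 = α
  swap
  · exact hd.eq_zero_of_add_ne (fun p hp => h0 0 p (by rintro rfl; simp at hp)) α i p hp
  obtain ⟨β, γ⟩ := p
  simp only at h1 h2 hp
  subst hp
  have key (i j : ℤ) : (weight R β + weight R γ) * d (β + γ) (i + j) (β, γ)
      = (((t ^ i : Rˣ) : R) * weight R β + ((s ^ i : Rˣ) : R) * weight R γ)
        * d (β + γ) j (β, γ) := by
    have h := hd 0 (β + γ) i j (β, γ)
    rw [act_zero_left] at h
    have e : act t s (β + γ) j (d 0 i) (β, γ) = 0 := by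
      rw [act, h0, h0]
      · simp
      · simpa [Prod.ext_iff] using fun h => absurd h h1
      · simp [Prod.ext_iff, h2]
    rw [e] at h
    simpa using h
  have k1 := key 1 0
  have k2 := key 2 0
  have k3 := key 1 1
  have hα' : weight R β + weight R γ ≠ 0 := by
    rw [← map_add]; exact weight_ne_zero hα
  have hX : d (β + γ) 0 (β, γ) = 0 := by
    have : (weight R β * weight R γ * ((t : R) - s) ^ 2) * d (β + γ) 0 (β, γ) = 0 := by
      norm_num at k1 k2 k3
      linear_combination (weight R β + weight R γ) * k3 - (weight R β + weight R γ) * k2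
        + (t * weight R β + s * weight R γ) * k1
    refine (mul_eq_zero.mp this).resolve_left ?_
    exact mul_ne_zero (mul_ne_zero (weight_ne_zero h1) (weight_ne_zero h2))
      (pow_ne_zero _ (sub_ne_zero.mpr hts))
  have h := key i 0
  rw [hX, mul_zero, add_zero] at h
  exact (mul_eq_zero.mp h).resolve_left hα'

/-- The components of a cocycle along `L_α ⊗ L_0` and `L_0 ⊗ L_α` depend on the loop degree
through `tⁱ`, respectively `sⁱ`, and the value at `L_{0,i}`. -/
theorem IsCocycle.apply_axis {d : Γ → ℤ → Γ × Γ → R} (hd : IsCocycle t s d)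
    (h0 : ∀ i, ∀ p : Γ × Γ, p ≠ 0 → d 0 i p = 0) (α : Γ) (hα : α ≠ 0) (i j : ℤ) :
    d α (i + j) (α, 0) = ((t ^ i : Rˣ) : R) * d α j (α, 0) + ((t ^ j : Rˣ) : R) * d 0 i 0 ∧
    d α (i + j) (0, α) = ((s ^ i : Rˣ) : R) * d α j (0, α) + ((s ^ j : Rˣ) : R) * d 0 i 0 := by
  have hw := weight_ne_zero (R := R) hα
  constructor
  · have h := hd 0 α i j (α, 0)
    rw [act_zero_left, act, h0 i (_, _ - α) (by simp [Prod.ext_iff, hα])] at h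
    refine mul_left_cancel₀ hw ?_
    simp only [sub_self, Prod.mk_zero_zero, map_sub, map_nsmul, sub_zero, zero_add, map_zero,
      nsmul_eq_mul] at h
    push_cast at h
    linear_combination h
  · have h := hd 0 α i j (0, α)
    rw [act_zero_left, act, h0 i (_ - α, _) (by simp [Prod.ext_iff, hα])] at h
    refine mul_left_cancel₀ hw ?_
    simp only [sub_self, Prod.mk_zero_zero, map_sub, map_nsmul, sub_zero, zero_add, map_zero,
      nsmul_eq_mul] at h
    push_cast at h
    linear_combination h

/-- The map `i ↦ D(L_{0,i})` is a derivation of Laurent polynomials with respect to both loop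
parameters at once, which forces it to vanish. -/
theorem IsCocycle.apply_zero [CharZero F] {d : Γ → ℤ → Γ × Γ → R} (hd : IsCocycle t s d)
    (hΓ : Γ ≠ ⊥) (hts : (t : R) ≠ s) (h0 : ∀ i, ∀ p : Γ × Γ, p ≠ 0 → d 0 i p = 0) (i : ℤ) :
    d 0 i = 0 := by
  obtain ⟨α, hα⟩ : ∃ α : Γ, α ≠ 0 := by
    obtain ⟨a, ha, h⟩ := Γ.bot_or_exists_ne_zero.resolve_left hΓ
    exact ⟨⟨a, ha⟩, by simpa [Subtype.ext_iff] using h⟩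
  have hR : CharZero R := charZero_of_injective_algebraMap (algebraMap F R).injective
  have ax := hd.apply_axis h0 α hα
  have e1 (i j : ℤ) : d 0 (i + j) 0
      = ((t ^ i : Rˣ) : R) * d 0 j 0 + ((t ^ j : Rˣ) : R) * d 0 i 0 := by
    have h1 := (ax (i + j) 0).1
    have h2 := (ax i j).1
    have h3 := (ax j 0).1
    simp only [add_zero, zpow_zero, Units.val_one, zpow_add, Units.val_mul] at h1 h3
    linear_combination -h1 + h2 + ((t ^ i : Rˣ) : R) * h3
  have e2 (i j : ℤ) : d 0 (i + j) 0
      = ((s ^ i : Rˣ) : R) * d 0 j 0 + ((s ^ j : Rˣ) : R) * d 0 i 0 := by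
    have h1 := (ax (i + j) 0).2
    have h2 := (ax i j).2
    have h3 := (ax j 0).2
    simp only [add_zero, zpow_zero, Units.val_one, zpow_add, Units.val_mul] at h1 h3
    linear_combination -h1 + h2 + ((s ^ i : Rˣ) : R) * h3
  have hts' : (t : R) - s ≠ 0 := sub_ne_zero.mpr hts
  have z1 : d 0 1 0 = 0 := by
    have : (2 * ((t : R) - s)) * d 0 1 0 = 0 := by
      have h1 := e1 1 1
      have h2 := e2 1 1
      rw [zpow_one] at h1 h2
      linear_combination h2 - h1
    exact (mul_eq_zero.mp this).resolve_left (mul_ne_zero two_ne_zero hts')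
  have z : d 0 i 0 = 0 := by
    have : ((t : R) - s) * d 0 i 0 = 0 := by
      have h1 := e1 1 i
      have h2 := e2 1 i
      rw [zpow_one, z1] at h1 h2
      linear_combination h2 - h1
    exact (mul_eq_zero.mp this).resolve_left hts'
  funext p
  by_cases hp : p = 0
  · rw [hp, z]; rfl
  · exact h0 i p hp

/-- A cocycle whose values at `L_{0,i}` are multiples of `L_0 ⊗ L_0` is the coboundary of a
multiple of `L_0 ⊗ L_0`. -/
theorem IsCocycle.exists_eq_act [CharZero F] {d : Γ → ℤ → Γ × Γ → R} (hd : IsCocycle t s d)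
    (hΓ : Γ ≠ ⊥) (hts : (t : R) ≠ s) (h0 : ∀ i, ∀ p : Γ × Γ, p ≠ 0 → d 0 i p = 0) :
    ∃ c : R, ∀ α i p, d α i p = act t s α i (Finsupp.single 0 c : Γ × Γ →₀ R) p := by
  classical
  have := infinite_of_ne_bot hΓ
  have hz := hd.apply_zero hΓ hts h0
  have ax := hd.apply_axis h0
  have hne (α : Γ) (hα : α ≠ 0) := hd.eq_zero_of_ne hts h0 α hα
  have hsum := hd.eq_zero_of_add_ne (fun p hp => by rw [hz]; rfl)
  have cross (α β : Γ) (hα : α ≠ 0) (hβ : β ≠ 0) (hαβ : α ≠ β) :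
      weight R β * d α 0 (0, α) = weight R α * d β 0 (β, 0) := by
    have h := hd α β 0 0 (β, α)
    have e1 : d (α + β) (0 + 0) (β, α) = 0 := by
      by_cases h : α + β = 0
      · rw [h, hz]; rfl
      · exact hne _ h _ _ hβ hα
    have e2 : d β 0 (β - α, α) = 0 := hne _ hβ _ _ (sub_ne_zero.mpr hαβ.symm) hα
    have e3 : d α 0 (β, α - β) = 0 := hne _ hα _ _ hβ (sub_ne_zero.mpr hαβ)
    simp only [act, e1, e2, e3, sub_self, map_sub, map_nsmul, nsmul_eq_mul, zpow_zero,
      Units.val_one] at h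
    push_cast at h
    linear_combination -h
  obtain ⟨α₀, hα₀⟩ := exists_ne (0 : Γ)
  -- The proportionality constant is read off at one weight `α₀` and carried to all others.
  set c : R := algebraMap F R (α₀ : F)⁻¹ * d α₀ 0 (0, α₀) with hc
  have hB₀ : d α₀ 0 (0, α₀) = weight R α₀ * c := by
    rw [hc]; linear_combination -d α₀ 0 (0, α₀) * weight_inv_mul (R := R) hα₀
  have hA (β : Γ) (hβ : β ≠ 0) (h : β ≠ α₀) : d β 0 (β, 0) = weight R β * c := by
    refine mul_left_cancel₀ (weight_ne_zero (R := R) hα₀) ?_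
    rw [← cross α₀ β hα₀ hβ h.symm, hB₀]; ring
  have hB (α : Γ) (hα : α ≠ 0) : d α 0 (0, α) = weight R α * c := by
    obtain ⟨β, hβ⟩ := Infinite.exists_notMem_finset ({0, α, α₀} : Finset Γ)
    simp only [Finset.mem_insert, Finset.mem_singleton, not_or] at hβ
    refine mul_left_cancel₀ (weight_ne_zero (R := R) hβ.1) ?_
    rw [cross α β hα hβ.1 (Ne.symm hβ.2.1), hA β hβ.1 hβ.2.2]; ring
  have hA' (β : Γ) (hβ : β ≠ 0) : d β 0 (β, 0) = weight R β * c := by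
    obtain ⟨α, hα⟩ := Infinite.exists_notMem_finset ({0, β} : Finset Γ)
    simp only [Finset.mem_insert, Finset.mem_singleton, not_or] at hα
    refine mul_left_cancel₀ (weight_ne_zero (R := R) hα.1) ?_
    rw [← cross α β hα.1 hβ hα.2, hB α hα.1]; ring
  refine ⟨-c, fun α i ⟨β, γ⟩ => ?_⟩
  by_cases hα : α = 0
  · subst hα
    rw [hz, act_zero_left]
    by_cases h : ((β, γ) : Γ × Γ) = 0
    · obtain ⟨rfl, rfl⟩ := Prod.ext_iff.mp h
      simp
    · rw [Finsupp.single_eq_of_ne h]; simp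
  have ht := (ax α hα i 0).1
  have hs := (ax α hα i 0).2
  rw [hz, Pi.zero_apply, mul_zero, add_zero, add_zero] at ht hs
  simp only [act]
  by_cases hβ : β = 0
  · subst hβ
    rw [Finsupp.single_eq_of_ne (by simp [Prod.ext_iff, hα])]
    by_cases hγ : γ = α
    · subst hγ
      rw [hs, hB _ hα, sub_self, Prod.mk_zero_zero, Finsupp.single_eq_same]
      simp only [map_sub, map_nsmul, nsmul_eq_mul]
      push_cast
      ring
    · rw [Finsupp.single_eq_of_ne (by simp [Prod.ext_iff, sub_eq_zero, hγ]),
        hsum _ _ _ (by simpa using hγ)]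
      simp
  rw [Finsupp.single_eq_of_ne (a' := ((β, γ - α) : Γ × Γ)) (by simp [Prod.ext_iff, hβ])]
  by_cases hγ : γ = 0
  · subst hγ
    by_cases hβα : β = α
    · subst hβα
      rw [ht, hA' _ hα, sub_self, Prod.mk_zero_zero, Finsupp.single_eq_same]
      simp only [map_sub, map_nsmul, nsmul_eq_mul]
      push_cast
      ring
    · rw [Finsupp.single_eq_of_ne (by simp [Prod.ext_iff, sub_eq_zero, hβα]),
        hsum _ _ _ (by simpa using hβα)]
      simp
  · rw [Finsupp.single_eq_of_ne (by simp [Prod.ext_iff, hγ]), hne α hα _ _ hβ hγ]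
    simp

/-! ### Finitely supported cocycles are coboundaries -/

/-- Every finitely supported cocycle is a coboundary. -/
theorem IsCocycle.exists_eq_act_finsupp [CharZero F] (hΓ : Γ ≠ ⊥) (hts : (t : R) ≠ s)
    (d : Γ → ℤ → Γ × Γ →₀ R) (hd : IsCocycle t s fun α i => d α i) :
    ∃ m : Γ × Γ →₀ R, ∀ α i p, d α i p = act t s α i m p := by
  classical
  have hts' : (t : R) - s ≠ 0 := sub_ne_zero.mpr hts
  -- `(t - s) D` minus the coboundary of `m` sends every `L_{0,i}` to a multiple of `L_0 ⊗ L_0`.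
  let f (p : Γ × Γ) : R :=
    if p.1 + p.2 = 0 then algebraMap F R (p.1 : F)⁻¹ * d 0 1 p
    else algebraMap F R ((p.1 + p.2 : Γ) : F)⁻¹ * ((t - s) * d 0 0 p)
  let m : Γ × Γ →₀ R := Finsupp.onFinset ((d 0 1).support ∪ (d 0 0).support) f (by
    intro p hp
    simp only [Finset.mem_union, Finsupp.mem_support_iff]
    by_contra! h
    exact hp (by simp [f, h.1, h.2]))
  have hm (p) : m p = f p := rfl
  have hd' := hd.mul_sub_act (t - s : R) m
  have hw : ∀ p : Γ × Γ, p.1 + p.2 ≠ 0 → (t - s : R) * d 0 0 p - act t s 0 0 m p = 0 := by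
    intro p hp
    rw [act_zero_left, hm]
    simp only [f, if_neg hp, zpow_zero, Units.val_one, one_mul, ← map_add]
    linear_combination -((t - s : R) * d 0 0 p) * weight_inv_mul (R := R) hp
  have h0 : ∀ i, ∀ p : Γ × Γ, p ≠ 0 → (t - s : R) * d 0 i p - act t s 0 i m p = 0 := by
    intro i p hp
    by_cases hsum : p.1 + p.2 = 0
    · have h1 : p.1 ≠ 0 := fun h => hp (Prod.ext h (by simpa [h] using hsum))
      have h2 : p.2 = -p.1 := (neg_eq_of_add_eq_zero_right hsum).symm
      have h := hd 0 0 i 1 p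
      simp only [act_zero_left, h2, map_neg, sub_self, map_zero, zero_mul, zpow_one] at h
      have hwp := weight_ne_zero (R := R) h1
      have h3 : (((t ^ i : Rˣ) : R) - ((s ^ i : Rˣ) : R)) * d 0 1 p = (t - s : R) * d 0 i p := by
        refine mul_left_cancel₀ hwp ?_
        linear_combination -h
      rw [act_zero_left, hm]
      simp only [f, if_pos hsum, h2, map_neg]
      linear_combination -(((t ^ i : Rˣ) : R) - ((s ^ i : Rˣ) : R)) * d 0 1 p
        * weight_inv_mul (R := R) h1 - h3
    · exact hd'.eq_zero_of_add_ne hw 0 i p hsum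
  obtain ⟨c, hc⟩ := hd'.exists_eq_act hΓ hts h0
  have hw (α i p) : (t - s : R) * d α i p
      = act t s α i (m + Finsupp.single 0 c : Γ × Γ →₀ R) p := by
    have h := hc α i p
    simp only [act, Finsupp.add_apply] at h ⊢
    linear_combination h
  -- Hence the primitive is invariant modulo `t - s`, so it is divisible by `t - s`.
  have hdvd := dvd_of_dvd_act (t := t) (s := s) hΓ (t - s : R) (m + Finsupp.single 0 c)
    fun α p => ⟨_, (hw α 0 p).symm⟩
  choose q hq using hdvd
  refine ⟨Finsupp.onFinset (m + Finsupp.single 0 c).support q ?_, fun α i p => ?_⟩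
  · intro p hp
    rw [Finsupp.mem_support_iff, hq]
    exact mul_ne_zero hts' hp
  · refine mul_left_cancel₀ hts' ?_
    rw [hw]
    simp only [act, hq, Finsupp.onFinset_apply]
    ring

end Core

/-! ### Coordinates on the tensor square -/

section Coordinates

variable (F : Type*) [Field F] (Γ : AddSubgroup F)

/-- The basis `L_{α,i}` of the loop Virasoro algebra, indexed by `(i, α)`. -/
noncomputable def basis : Module.Basis (ℤ × Γ) F (LoopVir F Γ) :=
  (AddMonoidAlgebra.basis ℤ F).tensorProduct ((AddMonoidAlgebra.basis Γ F).map WittAlg.ofCoef)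

theorem basis_apply (i : ℤ) (α : Γ) : basis F Γ (i, α) = L α i := by
  rw [basis, Module.Basis.tensorProduct_apply, Module.Basis.map_apply]
  rfl

/-- The reindexing of the basis `L_{β,j} ⊗ L_{γ,k}` by weights first and loop degrees second. -/
def indexEquiv : (ℤ × Γ) × (ℤ × Γ) ≃ Σ _ : Γ × Γ, ℤ × ℤ :=
  ((Equiv.prodProdProdComm ℤ Γ ℤ Γ).trans (Equiv.prodComm _ _)).trans
    (Equiv.sigmaEquivProd _ _).symm

/-- The coordinates of `𝓛 ⊗ 𝓛`: the coefficients of `L_β ⊗ L_γ` are Laurent polynomials in the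
loop parameters of the two factors, that is, elements of the group algebra of `ℤ × ℤ`. -/
noncomputable def coords :
    LoopVir F Γ ⊗[F] LoopVir F Γ ≃ₗ[F] (Γ × Γ →₀ AddMonoidAlgebra F (ℤ × ℤ)) :=
  ((basis F Γ).tensorProduct (basis F Γ)).equiv
    (Finsupp.basis fun _ => AddMonoidAlgebra.basis (ℤ × ℤ) F) (indexEquiv F Γ)

theorem coords_tmul (β γ : Γ) (j k : ℤ) :
    coords F Γ (L β j ⊗ₜ L γ k)
      = Finsupp.single (β, γ) (AddMonoidAlgebra.single (j, k) 1) := by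
  have h := ((basis F Γ).tensorProduct (basis F Γ)).equiv_apply ((j, β), (k, γ))
    (Finsupp.basis fun _ : Γ × Γ => AddMonoidAlgebra.basis (ℤ × ℤ) F) (indexEquiv F Γ)
  rw [Module.Basis.tensorProduct_apply, basis_apply, basis_apply, Finsupp.coe_basis] at h
  exact h

/-- A monomial, as a unit of the Laurent polynomial ring in two variables. -/
noncomputable def monomialUnit (u : ℤ × ℤ) : (AddMonoidAlgebra F (ℤ × ℤ))ˣ where
  val := AddMonoidAlgebra.single u 1
  inv := AddMonoidAlgebra.single (-u) 1
  val_inv := by simp [AddMonoidAlgebra.single_mul_single, AddMonoidAlgebra.one_def]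
  inv_val := by simp [AddMonoidAlgebra.single_mul_single, AddMonoidAlgebra.one_def]

theorem monomialUnit_zpow (u : ℤ × ℤ) (i : ℤ) :
    ((monomialUnit F u ^ i : (AddMonoidAlgebra F (ℤ × ℤ))ˣ) : AddMonoidAlgebra F (ℤ × ℤ))
      = AddMonoidAlgebra.single (i • u) 1 := by
  let φ : Multiplicative (ℤ × ℤ) →* (AddMonoidAlgebra F (ℤ × ℤ))ˣ :=
    { toFun v := monomialUnit F v.toAdd
      map_one' := Units.ext rfl
      map_mul' v w := Units.ext (by
        simp [monomialUnit, AddMonoidAlgebra.single_mul_single]) }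
  have h := map_zpow φ (Multiplicative.ofAdd u) i
  exact congrArg Units.val h.symm

variable {F Γ}

theorem coords_lie (α : Γ) (i : ℤ) (v : LoopVir F Γ ⊗[F] LoopVir F Γ) (p : Γ × Γ) :
    coords F Γ ⁅(L α i : LoopVir F Γ), v⁆ p
      = act (monomialUnit F (1, 0)) (monomialUnit F (0, 1)) α i (coords F Γ v) p := by
  classical
  -- Both sides are linear in `v`.
  let T : (Γ × Γ → AddMonoidAlgebra F (ℤ × ℤ)) →ₗ[F] AddMonoidAlgebra F (ℤ × ℤ) :=
    { toFun m := act (monomialUnit F (1, 0)) (monomialUnit F (0, 1)) α i m p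
      map_add' m n := by simp only [act, Pi.add_apply]; ring
      map_smul' c m := by
        simp only [act, Pi.smul_apply, Algebra.smul_def, RingHom.id_apply]; ring }
  have h : Finsupp.lapply p ∘ₗ (coords F Γ).toLinearMap ∘ₗ
        LieModule.toEnd F (LoopVir F Γ) (LoopVir F Γ ⊗[F] LoopVir F Γ) (L α i)
      = T ∘ₗ (Finsupp.lcoeFun ∘ₗ (coords F Γ).toLinearMap) := by
    refine ((basis F Γ).tensorProduct (basis F Γ)).ext fun ⟨⟨j, β⟩, ⟨k, γ⟩⟩ => ?_
    obtain ⟨a, b⟩ := p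
    rw [Module.Basis.tensorProduct_apply, basis_apply, basis_apply]
    change coords F Γ ⁅(L α i : LoopVir F Γ), (L β j ⊗ₜ[F] L γ k)⁆ (a, b)
      = act _ _ α i (coords F Γ (L β j ⊗ₜ[F] L γ k)) (a, b)
    rw [TensorProduct.LieModule.lie_tmul_right, lie_L, lie_L, ← TensorProduct.smul_tmul',
      TensorProduct.tmul_smul, map_add, map_smul, map_smul, coords_tmul, coords_tmul,
      coords_tmul, act, monomialUnit_zpow, monomialUnit_zpow]
    simp only [Finsupp.add_apply, Finsupp.smul_apply]
    have h1 : ((β : F) - α) • (Finsupp.single (α + β, γ)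
          (AddMonoidAlgebra.single (i + j, k) (1 : F)) : Γ × Γ →₀ _) (a, b)
        = AddMonoidAlgebra.single (i • ((1, 0) : ℤ × ℤ)) 1
          * weight (AddMonoidAlgebra F (ℤ × ℤ)) (a - 2 • α)
          * (Finsupp.single (β, γ) (AddMonoidAlgebra.single (j, k) (1 : F)) : Γ × Γ →₀ _)
            (a - α, b) := by
      by_cases h : (α + β, γ) = (a, b)
      · obtain ⟨rfl, rfl⟩ := Prod.ext_iff.mp h
        have e : α + β - 2 • α = β - α := by rw [two_nsmul]; abel
        rw [Finsupp.single_eq_same, add_sub_cancel_left, Finsupp.single_eq_same, e, weight_apply,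
          mul_right_comm, AddMonoidAlgebra.single_mul_single, mul_comm, ← Algebra.smul_def]
        simp
      · rw [Finsupp.single_eq_of_ne (Ne.symm h), Finsupp.single_eq_of_ne, smul_zero, mul_zero]
        rintro h'
        obtain ⟨rfl, rfl⟩ := Prod.ext_iff.mp h'
        simp at h
    have h2 : ((γ : F) - α) • (Finsupp.single (β, α + γ)
          (AddMonoidAlgebra.single (j, i + k) (1 : F)) : Γ × Γ →₀ _) (a, b)
        = AddMonoidAlgebra.single (i • ((0, 1) : ℤ × ℤ)) 1
          * weight (AddMonoidAlgebra F (ℤ × ℤ)) (b - 2 • α)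
          * (Finsupp.single (β, γ) (AddMonoidAlgebra.single (j, k) (1 : F)) : Γ × Γ →₀ _)
            (a, b - α) := by
      by_cases h : (β, α + γ) = (a, b)
      · obtain ⟨rfl, rfl⟩ := Prod.ext_iff.mp h
        have e : α + γ - 2 • α = γ - α := by rw [two_nsmul]; abel
        rw [Finsupp.single_eq_same, add_sub_cancel_left, Finsupp.single_eq_same, e, weight_apply,
          mul_right_comm, AddMonoidAlgebra.single_mul_single, mul_comm, ← Algebra.smul_def]
        simp
      · rw [Finsupp.single_eq_of_ne (Ne.symm h), Finsupp.single_eq_of_ne, smul_zero, mul_zero]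
        rintro h'
        obtain ⟨rfl, rfl⟩ := Prod.ext_iff.mp h'
        simp at h
    rw [h1, h2]
  exact LinearMap.congr_fun h v

end Coordinates

end LoopVir

/-! ### Vanishing of the first cohomology -/

theorem subsingleton_lieH1 (R L M : Type*) [CommRing R] [LieRing L] [LieAlgebra R L]
    [AddCommGroup M] [Module R M] [LieRingModule L M] [LieModule R L M]
    (h : ∀ D : LieDerivation R L M, ∃ v : M, ∀ x : L, D x = ⁅x, v⁆) :
    Subsingleton (LieH1 R L M) := by
  refine Submodule.Quotient.subsingleton_iff.mpr (Submodule.comap_subtype_eq_top.mpr ?_)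
  intro f hf
  have hf' (x y : L) : f ⁅x, y⁆ = ⁅x, f y⁆ - ⁅y, f x⁆ := by
    have e := LieModule.Cohomology.d₁₂_apply_apply R L M f x y
    rw [LinearMap.mem_ker.mp hf] at e
    exact (sub_eq_zero.mp e.symm).symm
  obtain ⟨v, hv⟩ := h ⟨f, hf'⟩
  exact ⟨v, LinearMap.ext fun x => (hv x).symm⟩

theorem proposition3p1 {F : Type*} [Field F] [CharZero F] (Γ : AddSubgroup F) (hΓ : Γ ≠ ⊥) :
    (∀ D : LieDerivation F (LoopVir F Γ) (LoopVir F Γ ⊗[F] LoopVir F Γ),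
      ∃ v : LoopVir F Γ ⊗[F] LoopVir F Γ, ∀ x : LoopVir F Γ, D x = ⁅x, v⁆) ∧
    Subsingleton (LieH1 F (LoopVir F Γ) (LoopVir F Γ ⊗[F] LoopVir F Γ)) := by
  have inner : ∀ D : LieDerivation F (LoopVir F Γ) (LoopVir F Γ ⊗[F] LoopVir F Γ),
      ∃ v : LoopVir F Γ ⊗[F] LoopVir F Γ, ∀ x : LoopVir F Γ, D x = ⁅x, v⁆ := by
    intro D
    have hts : ((LoopVir.monomialUnit F (1, 0) : (AddMonoidAlgebra F (ℤ × ℤ))ˣ) :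
        AddMonoidAlgebra F (ℤ × ℤ)) ≠ LoopVir.monomialUnit F (0, 1) := by
      intro h
      have := (AddMonoidAlgebra.basis (ℤ × ℤ) F).injective
        (a₁ := ((1, 0) : ℤ × ℤ)) (a₂ := (0, 1)) h
      simp at this
    obtain ⟨m, hm⟩ := LoopVir.IsCocycle.exists_eq_act_finsupp hΓ hts
      (fun α i => LoopVir.coords F Γ (D (LoopVir.L α i))) (by
        intro α β i j p
        have h := congrArg (fun v => LoopVir.coords F Γ v p)
          (D.apply_lie_eq_sub (LoopVir.L α i) (LoopVir.L β j))
        simp only [LoopVir.lie_L, map_smul, map_sub, Finsupp.smul_apply, Finsupp.sub_apply,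
          LoopVir.coords_lie] at h
        rw [← h, LoopVir.weight_apply, Algebra.smul_def, AddSubgroup.coe_sub])
    refine ⟨(LoopVir.coords F Γ).symm m, fun x => ?_⟩
    have h : (D : LoopVir F Γ →ₗ[F] LoopVir F Γ ⊗[F] LoopVir F Γ)
        = lieD₀₁ F (LoopVir F Γ) _ ((LoopVir.coords F Γ).symm m) := by
      refine (LoopVir.basis F Γ).ext fun ⟨i, α⟩ => ?_
      rw [LoopVir.basis_apply, lieD₀₁_apply]
      apply (LoopVir.coords F Γ).injective
      ext1 p
      rw [LoopVir.coords_lie, LinearEquiv.apply_symm_apply]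
      exact hm α i p
    exact LinearMap.congr_fun h x
  refine ⟨inner, ?_⟩
  exact subsingleton_lieH1 F _ _ inner
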